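/- Let $\mathbb{K}$ be a field and let $F=\mathbb{K}(q)$ be the field of rational functions over $\mathbb{K}$. Let $\mathcal{A}$ be the graded $F$-vector space with basis the isomorphism classes of finite simplicial complexes $\Gamma$, graded by the number of vertices, $\mathcal{A}=\bigoplus_{n\ge 0}A_n$, with coproduct $\Delta(\Gamma)=\sum_{T\subseteq V(\Gamma)}\Gamma_T\otimes\Gamma_{V(\Gamma)-T}$, where $\Gamma_T$ is the induced subcomplex on $T$, and with counit equal to $1$ on the complex without vertices and $0$ on all other complexes. For an integer $s\ge 1$ and $r\in F$ let $\zeta_{s,r}:\mathcal{A}\to F$ be the linear map with $$\zeta_{s,r}(\Gamma)=\begin{cases} r^{\,\mathrm{rk}(\Gamma^{(1)})} & \text{if }\dim\Gamma<s,\\ 0 & \text{if }\dim\Gamma\ge s,\end{cases}$$ where $\mathrm{rk}(\Gamma^{(1)})$ is the number of edges of a maximal spanning forest of the $1$-skeleton $\Gamma^{(1)}$. For a linear map $\zeta:\mathcal{A}\to F$ and a composition $\alpha=(\alpha_1,\dots,\alpha_k)$ let $\zeta_\alpha$ be the composite $$\mathcal{A}\xrightarrow{\Delta^{k-1}}\mathcal{A}^{\otimes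 k}\to A_{\alpha_1}\otimes\cdots\otimes A_{\alpha_k}\xrightarrow{\zeta^{\otimes k}}F$$ of the iterated coproduct, the canonical projection and $\zeta^{\otimes k}$ (for $k=0$ it is the counit), and let $\Psi_\zeta(h)=\sum_{\alpha\vDash n}\zeta_\alpha(h)M_\alpha$ for $h\in A_n$, where $M_\alpha=\sum_{i_1<\cdots<i_k}x_{i_1}^{\alpha_1}\cdots x_{i_k}^{\alpha_k}$ is the monomial quasi-symmetric function. For a quasi-symmetric function $f$ let $ps^1(f)(t)$, $t\in\mathbb{Z}$, be its principal specialization: the unique $F$-linear combination of the binomial polynomials $\binom{t}{k}$, $k\ge 0$, whose value at every integer $t\ge 0$ is $f$ evaluated at $x_1=\cdots=x_t=1$ and $x_i=0$ for $i>t$. **Proposition.** Let $T_n$ be any tree with $n$ vertices, regarded as a simplicial complex of dimension at most $1$, and let $s>1$ be an integer. Then $$ps^1\big(\Psi_{\zeta_{s,-q}}(T_n)\big)(-1)=(-1)^n(q+2)^{n-1}.$$ -/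

import Mathlib

open scoped TensorProduct

namespace SimplicialHopf

universe u v

/-! ### Simplicial complexes and their isomorphism classes -/

/-- A finite abstract simplicial complex. The ground set `V` is exactly the vertex set
(`AbstractSimplicialComplex` requires all singletons to be faces; the empty face is left implicit). -/
structure Complex : Type (u + 1) where
  V : Type u
  [finite : Finite V]
  faces : AbstractSimplicialComplex V

attribute [instance] Complex.finite

namespace Complex

/-- The dimension, i.e. the maximum of `|X| - 1` over the faces `X`
(faces are nonempty; the complex without vertices has dimension `⊥`). -/
noncomputable def dim (Γ : Complex.{u}) : WithBot ℕ∞ :=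
  ⨆ X ∈ Γ.faces, ((X.card - 1 : ℕ) : WithBot ℕ∞)

/-- The 1-skeleton, as a simple graph. -/
def skeletonOne (Γ : Complex.{u}) : SimpleGraph Γ.V where
  Adj a b := a ≠ b ∧ ∃ X ∈ Γ.faces, ∀ x, x ∈ X ↔ x = a ∨ x = b
  symm := ⟨by
    rintro a b ⟨h, X, hX, hx⟩
    exact ⟨h.symm, X, hX, fun x => (hx x).trans or_comm⟩⟩
  loopless := ⟨fun _ h => h.1 rfl⟩

/-- The induced complex `Γ_T`: its faces are the faces of `Γ` contained in `T`. -/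
def induced (Γ : Complex.{u}) (T : Set Γ.V) : Complex.{u} where
  V := T
  faces :=
    { faces := {X | X.map (Function.Embedding.subtype (· ∈ T)) ∈ Γ.faces}
      isRelLowerSet_faces := by
        intro X hX
        have h := Γ.faces.isRelLowerSet_faces hX
        exact ⟨by simpa using h.1, fun Y hYX hY =>
          h.2 (Finset.map_subset_map.2 hYX) (by simpa using hY)⟩
      singleton_mem := fun v => by
        have h : {v.1} ∈ Γ.faces := Γ.faces.singleton_mem v.1
        simpa using h }

/-- `e` is an isomorphism of simplicial complexes. -/
def IsIso (Γ Θ : Complex.{u}) (e : Γ.V ≃ Θ.V) : Prop :=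
  ∀ X : Finset Γ.V, X ∈ Γ.faces ↔ X.map e.toEmbedding ∈ Θ.faces

theorem IsIso.refl (Γ : Complex.{u}) : IsIso Γ Γ (Equiv.refl _) := fun X => by simp

theorem IsIso.symm {Γ Θ : Complex.{u}} {e : Γ.V ≃ Θ.V} (h : IsIso Γ Θ e) :
    IsIso Θ Γ e.symm := fun X => by
  have := h (X.map e.symm.toEmbedding)
  rw [this, Finset.map_map]
  simp

theorem IsIso.trans {Γ Θ Λ : Complex.{u}} {e : Γ.V ≃ Θ.V} {f : Θ.V ≃ Λ.V}
    (h : IsIso Γ Θ e) (k : IsIso Θ Λ f) : IsIso Γ Λ (e.trans f) := fun X => by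
  rw [h X, k _, Finset.map_map]
  rfl

instance setoid : Setoid Complex.{u} where
  r Γ Θ := ∃ e : Γ.V ≃ Θ.V, IsIso Γ Θ e
  iseqv :=
    { refl := fun Γ => ⟨_, IsIso.refl Γ⟩
      symm := fun ⟨_, h⟩ => ⟨_, h.symm⟩
      trans := fun ⟨_, h⟩ ⟨_, k⟩ => ⟨_, h.trans k⟩ }

end Complex

/-- Isomorphism classes of finite simplicial complexes. -/
def IsoClass : Type (u + 1) := Quotient Complex.setoid.{u}

/-- The isomorphism class `[Γ]`. -/
def Complex.cls (Γ : Complex.{u}) : IsoClass.{u} := Quotient.mk _ Γ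

/-- The number of vertices of (a representative of) an isomorphism class. -/
noncomputable def IsoClass.order (c : IsoClass.{u}) : ℕ :=
  Quotient.lift (fun Γ : Complex.{u} => Nat.card Γ.V)
    (by rintro _ _ ⟨e, _⟩; exact Nat.card_congr e) c

/-- The rank of a finite graph in its cycle matroid: the number of edges of a maximum spanning
forest. -/
noncomputable def graphRank {V : Type u} (G : SimpleGraph V) : ℕ :=
  sSup {k | ∃ H : SimpleGraph V, H ≤ G ∧ H.IsAcyclic ∧ H.edgeSet.ncard = k}

/-! ### The graded coalgebra of simplicial complexes -/

section Coalgebra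

variable (R : Type v) [CommRing R]

/-- The free `R`-module `𝒜` on the isomorphism classes of finite simplicial complexes. -/
abbrev Alg : Type (max (u + 1) v) := IsoClass.{u} →₀ R

/-- The basis element of `𝒜` given by a simplicial complex. -/
noncomputable def basisElt (Γ : Complex.{u}) : Alg.{u, v} R := Finsupp.single Γ.cls 1

/-- The homogeneous component `A_n`, spanned by the complexes with `n` vertices. -/
def component (n : ℕ) : Submodule R (Alg.{u, v} R) :=
  Finsupp.supported R R {c | c.order = n}

/-- The canonical projection `𝒜 → A_n`, viewed as an endomorphism of `𝒜`. -/
noncomputable def proj (n : ℕ) : Alg.{u, v} R →ₗ[R] Alg.{u, v} R :=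
  (component R n).subtype ∘ₗ Finsupp.restrictDom R R {c : IsoClass.{u} | c.order = n}

theorem Complex.IsIso.induced_cls {Γ Θ : Complex.{u}} {e : Γ.V ≃ Θ.V} (h : IsIso Γ Θ e)
    (T : Set Γ.V) : (Γ.induced T).cls = (Θ.induced (e '' T)).cls := by
  have key : ∀ X : Finset T, X.map (Function.Embedding.subtype (· ∈ T)) ∈ Γ.faces ↔
      (X.map (e.image T).toEmbedding).map (Function.Embedding.subtype (· ∈ e '' T)) ∈ Θ.faces := by
    intro X
    rw [h]
    rw [Finset.map_map, Finset.map_map]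
    rfl
  exact Quotient.sound ⟨e.image T, key⟩

/-- The coproduct of a complex, `Δ(Γ) = ∑_{T ⊆ V(Γ)} Γ_T ⊗ Γ_{V(Γ) - T}`. -/
noncomputable def comulComplex (Γ : Complex.{u}) : Alg.{u, v} R ⊗[R] Alg.{u, v} R :=
  ∑ᶠ T : Set Γ.V, basisElt R (Γ.induced T) ⊗ₜ[R] basisElt R (Γ.induced Tᶜ)

/-- The coproduct `Δ : 𝒜 → 𝒜 ⊗ 𝒜`. -/
noncomputable def comul : Alg.{u, v} R →ₗ[R] Alg.{u, v} R ⊗[R] Alg.{u, v} R :=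
  Finsupp.linearCombination R fun c : IsoClass.{u} =>
    Quotient.lift (comulComplex R) (by
      rintro Γ Θ ⟨e, h⟩
      unfold comulComplex
      rw [← finsum_comp_equiv (Equiv.Set.congr e)]
      refine finsum_congr fun T => ?_
      have h₁ := h.induced_cls T
      have h₂ := h.induced_cls Tᶜ
      rw [Set.image_compl_eq e.bijective] at h₂
      simp only [basisElt, h₁, h₂]
      rfl) c

/-- The counit `ε : 𝒜 → R`, which is `1` on the complex without vertices and `0` on all other
complexes. -/
noncomputable def counit : Alg.{u, v} R →ₗ[R] R :=
  Finsupp.linearCombination R fun c : IsoClass.{u} => if c.order = 0 then 1 else 0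

/-- The iterated coproduct `𝒜 → 𝒜^{⊗ k}` (usually written `Δ^{k-1}`): it is `ε` for `k = 0`,
and `Δ^{k} = (Δ^{k-1} ⊗ id) ∘ Δ`. -/
noncomputable def iterComul : (k : ℕ) → Alg.{u, v} R →ₗ[R] ⨂[R]^k (Alg.{u, v} R)
  | 0 => (PiTensorProduct.isEmptyEquiv (Fin 0)).symm.toLinearMap ∘ₗ counit R
  | k + 1 =>
    (TensorPower.mulEquiv (R := R) (M := Alg.{u, v} R) (n := k) (m := 1)).toLinearMap ∘ₗ
      TensorProduct.map (iterComul k)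
        (PiTensorProduct.subsingletonEquiv (0 : Fin 1)).symm.toLinearMap ∘ₗ comul R

variable {R}

/-- `ζ_α`, the composite `𝒜 → 𝒜^{⊗ k} → A_{α₁} ⊗ ⋯ ⊗ A_{αₖ} → R` of the iterated coproduct, the
canonical projection and `ζ^{⊗ k}`. -/
noncomputable def zetaComp (ζ : Alg.{u, v} R →ₗ[R] R) {n : ℕ} (α : Composition n) :
    Alg.{u, v} R →ₗ[R] R :=
  PiTensorProduct.lift
      ((MultilinearMap.mkPiAlgebra R (Fin α.length) R).compLinearMap fun i =>
        ζ ∘ₗ proj R (α.blocksFun i)) ∘ₗ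
    iterComul R α.length

end Coalgebra

/-! ### Quasi-symmetric functions -/

section QuasiSymmetric

variable (R : Type v) [CommRing R]

open Classical in
/-- The monomial quasi-symmetric function
`M_α = ∑_{i₁ < ⋯ < iₗ} x_{i₁}^{α₁} ⋯ x_{iₗ}^{αₗ}`, a formal power series in the variables
`x_0, x_1, x_2, …`. As the parts are positive, each monomial arises from at most one sequence
`i₁ < ⋯ < iₗ`, so that all coefficients are `0` or `1`. -/
noncomputable def monomialQSym {n : ℕ} (α : Composition n) : MvPowerSeries ℕ R := fun m =>
  if ∃ i : Fin α.length → ℕ, StrictMono i ∧ m = ∑ j, Finsupp.single (i j) (α.blocksFun j)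
  then 1 else 0

/-- The module of quasi-symmetric functions, spanned by the `M_α`. -/
noncomputable def QSym : Submodule R (MvPowerSeries ℕ R) :=
  Submodule.span R (Set.range fun a : Σ n, Composition n => monomialQSym R a.2)

theorem monomialQSym_mem {n : ℕ} (α : Composition n) : monomialQSym R α ∈ QSym R :=
  Submodule.subset_span ⟨⟨n, α⟩, rfl⟩

variable {R}

/-- The map `Ψ_ζ : 𝒜 → QSym` given by `Ψ_ζ(h) = ∑_{α ⊨ n} ζ_α(h) M_α` for `h ∈ A_n`. -/
noncomputable def psi (ζ : Alg.{u, v} R →ₗ[R] R) : Alg.{u, v} R →ₗ[R] QSym R :=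
  Finsupp.linearCombination R fun c : IsoClass.{u} =>
    ∑ α : Composition c.order,
      zetaComp ζ α (Finsupp.single c 1) • (⟨monomialQSym R α, monomialQSym_mem R α⟩ : QSym R)

/-- The value of a quasi-symmetric function when its first `t` variables are set to `1` and all
other variables to `0`. (Quasi-symmetric functions have bounded degree, so that only finitely many
terms are nonzero.) -/
noncomputable def evalOnes (f : QSym R) (t : ℕ) : R :=
  ∑ᶠ m : ℕ →₀ ℕ, MvPowerSeries.coeff m f.1 * m.prod fun i e => (if i < t then 1 else 0) ^ e

/-- `p` is the principal specialization `ps¹(f)` of `f`, as a polynomial function of an integer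
variable `t`: for natural numbers `t` it is the value of `f` at `1, …, 1, 0, 0, …` with `t` ones, and
it is a linear combination of the polynomials `t ↦ binom(t, k)`. Over a field of characteristic
zero these are exactly the polynomial functions of `t`; the binomial form makes sense in every
characteristic. By `IsPrincipalSpec.unique` there is at most one such `p`. -/
def IsPrincipalSpec (f : QSym R) (p : ℤ → R) : Prop :=
  (∀ t : ℕ, p t = evalOnes f t) ∧
    ∃ c : ℕ →₀ R, ∀ t : ℤ, p t = c.sum fun k a => a * (Ring.choose t k : ℤ)

theorem IsPrincipalSpec.unique {f : QSym R} {p p' : ℤ → R} (h : IsPrincipalSpec f p)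
    (h' : IsPrincipalSpec f p') : p = p' := by
  obtain ⟨h, c, hc⟩ := h
  obtain ⟨h', c', hc'⟩ := h'
  have key : ∀ k, c k = c' k := by
    intro k
    induction k using Nat.strong_induction_on with
    | _ k ih =>
      have hk : p k = p' k := by rw [h, h']
      have hs : ∀ d : ℕ →₀ R, (d.sum fun j a => a * ((Ring.choose (k : ℤ) j : ℤ) : R)) =
          (∑ j ∈ Finset.range k, d j * (k.choose j : R)) + d k := by
        intro d
        have h1 : (d.sum fun j a => a * ((Ring.choose (k : ℤ) j : ℤ) : R)) =
            ∑ j ∈ d.support ∪ Finset.range (k + 1), d j * (k.choose j : R) := by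
          rw [Finsupp.sum_of_support_subset d
            (Finset.subset_union_left (s₂ := Finset.range (k + 1))) _ (by simp)]
          simp [Ring.choose_natCast]
        rw [h1, ← Finset.sum_subset (Finset.subset_union_right (s₁ := d.support)),
          Finset.sum_range_succ]
        · simp
        · intro j _ hj
          rw [Finset.mem_range, not_lt] at hj
          rw [Nat.choose_eq_zero_of_lt hj]
          simp
      rw [hc, hc', hs, hs] at hk
      rw [Finset.sum_congr rfl fun j hj => by rw [ih j (Finset.mem_range.1 hj)]] at hk
      exact add_left_cancel hk
  have : c = c' := Finsupp.ext key
  subst this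
  funext t
  rw [hc, hc']

end QuasiSymmetric

/-! ### The characters -/

section Characters

theorem Complex.IsIso.dim_le {Γ Θ : Complex.{u}} {e : Γ.V ≃ Θ.V} (h : IsIso Γ Θ e) :
    Γ.dim ≤ Θ.dim := by
  unfold Complex.dim
  refine iSup₂_le fun X hX => ?_
  have := le_iSup₂ (f := fun (Y : Finset Θ.V) (_ : Y ∈ Θ.faces) =>
    ((Y.card - 1 : ℕ) : WithBot ℕ∞)) _ ((h X).1 hX)
  simpa using this

theorem Complex.IsIso.adj {Γ Θ : Complex.{u}} {e : Γ.V ≃ Θ.V} (h : IsIso Γ Θ e) {a b : Γ.V}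
    (hab : Γ.skeletonOne.Adj a b) : Θ.skeletonOne.Adj (e a) (e b) := by
  obtain ⟨hne, X, hX, hx⟩ := hab
  refine ⟨e.injective.ne hne, _, (h X).1 hX, fun x => ?_⟩
  obtain ⟨y, rfl⟩ := e.surjective x
  simp [hx]

theorem graphRank_congr {V W : Type u} {G : SimpleGraph V} {H : SimpleGraph W} (e : G ≃g H) :
    graphRank G = graphRank H := by
  have key : ∀ {V W : Type u} {G : SimpleGraph V} {H : SimpleGraph W}, (G ≃g H) → ∀ k,
      (∃ L : SimpleGraph V, L ≤ G ∧ L.IsAcyclic ∧ L.edgeSet.ncard = k) →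
      (∃ L : SimpleGraph W, L ≤ H ∧ L.IsAcyclic ∧ L.edgeSet.ncard = k) := by
    rintro V W G H e k ⟨L, hL, hac, hk⟩
    let i : L ≃g L.map e.toEquiv.toEmbedding := SimpleGraph.Iso.map e.toEquiv L
    refine ⟨L.map e.toEquiv.toEmbedding, ?_, i.isAcyclic_iff.1 hac, ?_⟩
    · rw [SimpleGraph.map_le_iff_le_comap]
      intro a b hab
      exact e.map_adj_iff.2 (hL hab)
    · rw [← hk]
      exact (Nat.card_congr i.mapEdgeSet).symm
  unfold graphRank
  congr 1
  ext k
  exact ⟨key e k, key e.symm k⟩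

variable {R : Type v} [CommRing R]

open Classical in
/-- The value `ζ_{s,q}(Γ) = q^{rk(Γ^{(1)})} ζ_s(Γ)`, where `ζ_s(Γ)` is `1` if `dim Γ < s` and `0`
otherwise. -/
noncomputable def zetaComplex (s : ℕ) (q : R) (Γ : Complex.{u}) : R :=
  q ^ graphRank Γ.skeletonOne * if Γ.dim < (s : WithBot ℕ∞) then 1 else 0

/-- The linear functional `ζ_{s,q} : 𝒜 → R`. -/
noncomputable def zeta (s : ℕ) (q : R) : Alg.{u, v} R →ₗ[R] R :=
  Finsupp.linearCombination R fun c : IsoClass.{u} =>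
    Quotient.lift (zetaComplex s q) (by
      rintro Γ Θ ⟨e, h⟩
      have hd : Γ.dim = Θ.dim := le_antisymm h.dim_le h.symm.dim_le
      have hr : graphRank Γ.skeletonOne = graphRank Θ.skeletonOne :=
        graphRank_congr
          { toEquiv := e
            map_rel_iff' := ⟨fun hab => by simpa using h.symm.adj hab, h.adj⟩ }
      simp only [zetaComplex, hd, hr]) c

end Characters

/-- A finite graph, regarded as a simplicial complex of dimension at most one: the faces are the
vertices and the edges. -/
def ofGraph {V : Type u} [Finite V] [DecidableEq V] (G : SimpleGraph V) : Complex.{u} where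
  V := V
  faces := Geometry.AbstractSimplicialComplex.ofSimpleGraph G

end SimplicialHopf

namespace SimplicialHopf
universe u v

/-! ### Functionals on the iterated coproduct -/

namespace Complex

/-! Setting the first t variables of Ψ_ζ(Γ) to 1 gives the t-fold convolution power of ζ at Γ: a sum
over all colourings g : V → Fin t of the product of the values of ζ on the colour classes
(`evalOnes_psi_basisElt`). This combines the expansion of the iterated coproduct over ordered
partitions (`lift_iterComul_basisElt`) with the fact that a monomial determines its composition.

For a forest and s > 1, the character ζ_{s,x} takes the value x^e on an induced subcomplex with e
edges. The product over colour classes therefore becomes a product over edges, with x for each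
monochromatic edge and 1 for every other (`prod_zeta_fibers`). This is the Potts partition function.
Removing a leaf divides it by t - 1 + x, so a tree on n vertices gives t(t - 1 + x)^(n-1)
(`sum_prod_isDiag_of_isTree`).

This polynomial is a combination of binomials in t (`exists_binomial_combination`), hence is the
principal specialization. Putting t = -1 and x = -q gives -(-2 - q)^(n-1). -/

theorem induced_induced_cls (Γ : Complex.{u}) (S : Set Γ.V) (U : Set (Γ.induced S).V) :
    ((Γ.induced S).induced U).cls = (Γ.induced (Subtype.val '' U : Set Γ.V)).cls := by
  have key : ∀ (U : Set S) (X : Finset U),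
      (X.map (Function.Embedding.subtype (· ∈ U))).map (Function.Embedding.subtype (· ∈ S)) ∈
        Γ.faces ↔
      (X.map (Equiv.Set.image Subtype.val U Subtype.val_injective).toEmbedding).map
        (Function.Embedding.subtype (· ∈ Subtype.val '' U)) ∈ Γ.faces := by
    intro U X
    rw [Finset.map_map, Finset.map_map]
    rfl
  exact Quotient.sound ⟨Equiv.Set.image Subtype.val U Subtype.val_injective, key U⟩

theorem order_cls (Γ : Complex.{u}) : Γ.cls.order = Nat.card Γ.V := rfl

end Complex

section

variable {R : Type v} [CommRing R]

theorem comul_basisElt (Γ : Complex.{u}) :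
    comul R (basisElt R Γ) =
      ∑ᶠ T : Set Γ.V, basisElt R (Γ.induced T) ⊗ₜ[R] basisElt R (Γ.induced Tᶜ) := by
  unfold comul basisElt
  rw [Finsupp.linearCombination_single, one_smul]
  rfl

/-- By linearity it is enough to treat pure tensors in a, where multiplication in the tensor power
is concatenation. This splits off the last factor in the induction on the number of blocks. -/
theorem lift_mulEquiv_tmul {M : Type*} [AddCommGroup M] [Module R M] {k : ℕ}
    (φ : Fin (k + 1) → M →ₗ[R] R) (a : ⨂[R]^k M) (y : M) :
    PiTensorProduct.lift ((MultilinearMap.mkPiAlgebra R (Fin (k + 1)) R).compLinearMap φ)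
        (TensorPower.mulEquiv (R := R) (M := M) (n := k) (m := 1)
          (a ⊗ₜ[R] (PiTensorProduct.subsingletonEquiv (0 : Fin 1)).symm y)) =
      PiTensorProduct.lift ((MultilinearMap.mkPiAlgebra R (Fin k) R).compLinearMap
        fun i => φ i.castSucc) a * φ (Fin.last k) y := by
  induction a using PiTensorProduct.induction_on with
  | smul_tprod r f =>
    rw [← TensorProduct.smul_tmul', map_smul, map_smul, map_smul]
    have h : (PiTensorProduct.subsingletonEquiv (R := R) (s := fun _ : Fin 1 => M)
        (0 : Fin 1)).symm y = PiTensorProduct.tprod R fun _ => y := by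
      rw [LinearEquiv.symm_apply_eq, PiTensorProduct.subsingletonEquiv_apply_tprod]
    rw [h, ← TensorPower.gMul_def, TensorPower.tprod_mul_tprod]
    simp only [PiTensorProduct.lift.tprod, MultilinearMap.compLinearMap_apply,
      MultilinearMap.mkPiAlgebra_apply, smul_eq_mul]
    rw [Fin.prod_univ_castSucc, mul_assoc]
    congr 2
    · exact Finset.prod_congr rfl fun i _ => congrArg _ (Fin.append_left f (fun _ : Fin 1 => y) i)
    · exact congrArg _ (Fin.append_right f (fun _ : Fin 1 => y) 0)
  | add a b ha hb =>
    rw [TensorProduct.add_tmul, map_add, map_add, ha, hb, map_add, add_mul]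

/-- Evaluating a product of functionals on the iterated coproduct of `Γ` sums over all
ordered partitions of the vertex set into possibly empty blocks. -/
theorem lift_iterComul_basisElt (k : ℕ) (φ : Fin k → Alg.{u, v} R →ₗ[R] R) (Γ : Complex.{u})
    [Fintype Γ.V] [DecidableEq Γ.V] :
    PiTensorProduct.lift ((MultilinearMap.mkPiAlgebra R (Fin k) R).compLinearMap φ)
        (iterComul R k (basisElt R Γ)) =
      ∑ f : Γ.V → Fin k, ∏ i, φ i (basisElt R (Γ.induced {v | f v = i})) := by
  classical
  induction k generalizing Γ with
  | zero =>
    have h : counit R (basisElt R Γ) = if Nat.card Γ.V = 0 then 1 else 0 := by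
      unfold counit basisElt
      rw [Finsupp.linearCombination_single, one_smul, Complex.order_cls]
    simp only [iterComul, LinearMap.comp_apply, h, LinearEquiv.coe_coe,
      Finset.univ_eq_empty, Finset.prod_empty, Finset.sum_const, Finset.card_univ,
      PiTensorProduct.isEmptyEquiv_symm_apply, map_smul, PiTensorProduct.lift.tprod]
    simp only [Fintype.card_fun, Fintype.card_fin, MultilinearMap.compLinearMap_apply,
      MultilinearMap.mkPiAlgebra_apply, Finset.univ_eq_empty, Finset.prod_empty]
    rw [Nat.card_eq_fintype_card (α := Γ.V)]
    -- The number of maps V → Fin 0 is 0 ^ |V|, which is the counit.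
    split_ifs with h0
    · simp [h0]
    · simp [h0]
  | succ k ih =>
    simp only [iterComul, LinearMap.comp_apply, LinearEquiv.coe_coe]
    rw [comul_basisElt, finsum_eq_sum_of_fintype]
    simp only [map_sum, TensorProduct.map_tmul, LinearEquiv.coe_coe, lift_mulEquiv_tmul]
    -- Group the colourings by the set T of vertices outside the last block: T indexes the outer
    -- coproduct, and its complement is the last block.
    rw [← Finset.sum_fiberwise (Finset.univ : Finset (Γ.V → Fin (k + 1)))
      (fun f => ({v | f v ≠ Fin.last k} : Set Γ.V))]
    refine Finset.sum_congr rfl fun T _ => ?_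
    let _ : Fintype (Γ.induced T).V := Fintype.ofFinite _
    rw [ih (fun i => φ i.castSucc) (Γ.induced T), Finset.sum_mul]
    refine Finset.sum_bij (fun f _ v => if h : v ∈ T then (f ⟨v, h⟩).castSucc else Fin.last k)
      ?_ ?_ ?_ ?_
    · intro f _
      simp only [Finset.mem_filter, Finset.mem_univ, true_and]
      ext v
      by_cases hv : v ∈ T <;> simp [hv, Fin.castSucc_ne_last]
    · intro f _ g _ h
      funext ⟨v, hv⟩
      have := congrFun h v
      simpa [hv] using this
    · intro g hg
      simp only [Finset.mem_filter, Finset.mem_univ, true_and] at hg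
      have hT : ∀ v, v ∈ T ↔ g v ≠ Fin.last k := fun v => by rw [← hg]; rfl
      refine ⟨fun v => (g v.1).castPred ((hT v.1).1 v.2), Finset.mem_univ _, ?_⟩
      funext v
      by_cases hv : v ∈ T
      · simp [hv]
      · simp only [hv, dite_false]
        by_contra h
        exact hv ((hT v).2 fun h' => h h'.symm)
    · intro f _
      rw [Fin.prod_univ_castSucc]
      congr 1
      · refine Finset.prod_congr rfl fun i _ => congrArg _ ?_
        unfold basisElt
        rw [Complex.induced_induced_cls]
        congr 3
        ext v
        constructor
        · rintro ⟨w, hw, rfl⟩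
          have h1 : w.1 ∈ T := w.2
          have h2 : f w = i := hw
          simp only [Set.mem_ofPred_eq, h1, dite_true]
          exact congrArg _ h2
        · intro hv
          by_cases h : v ∈ T
          · simp only [Set.mem_ofPred_eq, h, dite_true, Fin.castSucc_inj] at hv
            exact ⟨⟨v, h⟩, hv, rfl⟩
          · simp only [Set.mem_ofPred_eq, h, dite_false] at hv
            exact absurd hv.symm (Fin.castSucc_ne_last i)
      · congr 3
        ext v
        by_cases h : v ∈ T <;> simp [h, Fin.castSucc_ne_last]

end


/-! ### Monomials, compositions and colourings -/

section Counting

/-- The exponent of the monomial `∏ v, x_{g v}`. -/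
noncomputable def fiberCount {V : Type*} [Fintype V] (g : V → ℕ) : ℕ →₀ ℕ :=
  ∑ v, Finsupp.single (g v) 1

theorem fiberCount_apply {V : Type*} [Fintype V] (g : V → ℕ) (n : ℕ) :
    fiberCount g n = Nat.card {v | g v = n} := by
  classical
  have h : Nat.card {v | g v = n} = (Finset.univ.filter fun v => g v = n).card := by
    rw [Nat.card_eq_fintype_card, Fintype.card_subtype]
    rfl
  rw [h, fiberCount, Finsupp.finsetSum_apply, Finset.card_filter]
  exact Finset.sum_congr rfl fun v _ => Finsupp.single_apply

theorem sum_single_apply {k : ℕ} {i : Fin k → ℕ} (hi : Function.Injective i) (a : Fin k → ℕ)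
    (j : Fin k) : (∑ l, Finsupp.single (i l) (a l)) (i j) = a j := by
  rw [Finsupp.finsetSum_apply, Finset.sum_eq_single j]
  · simp
  · intro l _ hl
    rw [Finsupp.single_apply, if_neg fun h => hl (hi h)]
  · simp

theorem exists_of_sum_single_ne_zero {k : ℕ} {i : Fin k → ℕ} {a : Fin k → ℕ} {n : ℕ}
    (h : (∑ l, Finsupp.single (i l) (a l)) n ≠ 0) : ∃ j, i j = n := by
  rw [Finsupp.finsetSum_apply] at h
  obtain ⟨j, _, hj⟩ := Finset.exists_ne_zero_of_sum_ne_zero h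
  refine ⟨j, ?_⟩
  by_contra hne
  exact hj (by rw [Finsupp.single_apply, if_neg hne])

/-- A finite set has only one increasing enumeration. Lists absorb the fact that k and the size of
the support are only propositionally equal. -/
theorem ofFn_eq_of_strictMono (m : ℕ →₀ ℕ) {k : ℕ} {i : Fin k → ℕ} (hi : StrictMono i)
    (hs : Finset.univ.image i = m.support) :
    List.ofFn (fun j => m (i j)) =
      List.ofFn (fun j => m (m.support.orderEmbOfFin rfl j)) := by
  have hk : m.support.card = k := by
    rw [← hs, Finset.card_image_of_injective _ hi.injective, Finset.card_univ, Fintype.card_fin]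
  subst hk
  have := Finset.orderEmbOfFin_unique (s := m.support) rfl (f := i)
    (fun x => by rw [← hs]; exact Finset.mem_image_of_mem _ (Finset.mem_univ _)) hi
  rw [this]

/-- The composition whose parts are the exponents of the monomial `x^m` is unique. -/
theorem composition_unique {n : ℕ} {m : ℕ →₀ ℕ} {α β : Composition n}
    (hα : ∃ i : Fin α.length → ℕ, StrictMono i ∧ m = ∑ j, Finsupp.single (i j) (α.blocksFun j))
    (hβ : ∃ i : Fin β.length → ℕ, StrictMono i ∧ m = ∑ j, Finsupp.single (i j) (β.blocksFun j)) :
    α = β := by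
  have key : ∀ γ : Composition n, (∃ i : Fin γ.length → ℕ, StrictMono i ∧
      m = ∑ j, Finsupp.single (i j) (γ.blocksFun j)) →
      γ.blocks = List.ofFn (fun j => m (m.support.orderEmbOfFin rfl j)) := by
    rintro γ ⟨i, hi, hm⟩
    have happ : ∀ j, m (i j) = γ.blocksFun j := fun j => by
      rw [hm]
      exact sum_single_apply hi.injective _ j
    rw [← ofFn_eq_of_strictMono m hi, ← γ.ofFn_blocksFun]
    · simp only [happ]
    · ext x
      simp only [Finset.mem_image, Finset.mem_univ, true_and, Finsupp.mem_support_iff]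
      constructor
      · rintro ⟨j, rfl⟩
        rw [happ]
        exact Nat.one_le_iff_ne_zero.1 (γ.one_le_blocksFun j)
      · intro hx
        rw [hm] at hx
        exact exists_of_sum_single_ne_zero hx
  exact Composition.ext ((key α hα).trans (key β hβ).symm)

/-- The parts are the nonzero exponents of m, read in increasing order of the variables. -/
theorem exists_composition {n : ℕ} {m : ℕ →₀ ℕ} (hm : (m.sum fun _ a => a) = n) :
    ∃ (α : Composition n) (i : Fin α.length → ℕ),
      StrictMono i ∧ m = ∑ j, Finsupp.single (i j) (α.blocksFun j) := by
  have key : ∀ (k : ℕ) (e : Fin k → ℕ), StrictMono e →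
      m = ∑ j, Finsupp.single (e j) (m (e j)) → (∀ j, 0 < m (e j)) →
      ∃ (α : Composition n) (i : Fin α.length → ℕ),
        StrictMono i ∧ m = ∑ j, Finsupp.single (i j) (α.blocksFun j) := by
    intro k e he hme hpos
    have hsum : (List.ofFn fun j => m (e j)).sum = n := by
      rw [List.sum_ofFn, ← hm]
      conv_rhs => rw [hme]
      rw [← Finsupp.sum_finsetSum_index (by simp) (by simp)]
      simp
    let α : Composition n :=
      ⟨List.ofFn fun j => m (e j), fun {x} hx => by
        obtain ⟨j, rfl⟩ := (List.mem_ofFn' _ _).1 hx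
        exact hpos j, hsum⟩
    have hl : α.length = k := List.length_ofFn
    have hb : ∀ j : Fin α.length, α.blocksFun j = m (e (Fin.cast hl j)) := fun j => by
      simp [α, Composition.blocksFun, Fin.cast]
    refine ⟨α, fun j => e (Fin.cast hl j), fun a b hab => he hab, ?_⟩
    simp only [hb]
    conv_lhs => rw [hme]
    exact ((finCongr hl).sum_comp fun j => Finsupp.single (e j) (m (e j))).symm
  refine key _ (m.support.orderEmbOfFin rfl) (OrderEmbedding.strictMono _) ?_ ?_
  · have h := Finset.sum_image (s := Finset.univ) (f := fun x => Finsupp.single x (m x))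
      (g := m.support.orderEmbOfFin rfl) (OrderEmbedding.strictMono _).injective.injOn
    rw [← h, Finset.image_orderEmbOfFin_univ]
    exact m.sum_single.symm
  · intro j
    exact Nat.pos_of_ne_zero (Finsupp.mem_support_iff.1 (Finset.orderEmbOfFin_mem _ _ j))

theorem fiberCount_degree {V : Type*} [Fintype V] (g : V → ℕ) :
    ((fiberCount g).sum fun _ a => a) = Nat.card V := by
  rw [fiberCount, ← Finsupp.sum_finsetSum_index (by simp) (by simp)]
  simp

variable {R : Type v} [CommRing R]

/-- Inserting empty blocks does not change a sum of products over ordered partitions. -/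
theorem sum_prod_fibers_eq {V : Type*} [Fintype V] [DecidableEq V] (z : Set V → R) (hz : z ∅ = 1)
    {k t : ℕ} (a : Fin k → ℕ) (i : Fin k → Fin t) (hi : Function.Injective i) :
    (∑ f : V → Fin k, ∏ j, if Nat.card {v | f v = j} = a j then z {v | f v = j} else 0) =
      ∑ g : V → Fin t with
        fiberCount (fun v => (g v : ℕ)) = ∑ j, Finsupp.single (i j : ℕ) (a j),
        ∏ j, z {v | g v = j} := by
  classical
  have hi' : Function.Injective fun j => (i j : ℕ) := Fin.val_injective.comp hi
  have hfib : ∀ (f : V → Fin k) (j : Fin k),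
      fiberCount (fun v => (i (f v) : ℕ)) (i j) = Nat.card {v | f v = j} := fun f j => by
    rw [fiberCount_apply]
    simp only [Fin.val_inj, hi.eq_iff]
  have hL : ∀ f : V → Fin k,
      (∏ j, if Nat.card {v | f v = j} = a j then z {v | f v = j} else 0) =
        if ∀ j, Nat.card {v | f v = j} = a j then ∏ j, z {v | f v = j} else 0 := by
    intro f
    split_ifs with h
    · exact Finset.prod_congr rfl fun j _ => if_pos (h j)
    · push Not at h
      obtain ⟨j, hj⟩ := h
      exact Finset.prod_eq_zero (Finset.mem_univ j) (if_neg hj)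
  simp only [hL]
  rw [← Finset.sum_filter]
  refine Finset.sum_bij (fun f _ v => i (f v)) ?_ ?_ ?_ ?_
  · intro f hf
    simp only [Finset.mem_filter, Finset.mem_univ, true_and] at hf ⊢
    ext n
    by_cases hn : ∃ j, (i j : ℕ) = n
    · obtain ⟨j, rfl⟩ := hn
      rw [hfib, hf, sum_single_apply hi']
    · have h1 : (∑ j, Finsupp.single (i j : ℕ) (a j)) n = 0 := by
        by_contra h
        exact hn (exists_of_sum_single_ne_zero h)
      rw [h1, fiberCount_apply]
      have : IsEmpty {v | (i (f v) : ℕ) = n} := ⟨fun v => hn ⟨f v.1, v.2⟩⟩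
      exact Nat.card_of_isEmpty
  · intro f _ g _ h
    funext v
    exact hi (congrFun h v)
  · intro g hg
    simp only [Finset.mem_filter, Finset.mem_univ, true_and] at hg
    -- Every colour used by g has a positive exponent in the monomial, so it lies in the range of i
    -- and g factors through i.
    have hex : ∀ v, ∃ j, i j = g v := by
      intro v
      have hne : fiberCount (fun v => (g v : ℕ)) (g v) ≠ 0 := by
        rw [fiberCount_apply]
        have : Nonempty {w | (g w : ℕ) = g v} := ⟨⟨v, rfl⟩⟩
        exact Nat.card_pos.ne'
      rw [hg] at hne
      obtain ⟨j, hj⟩ := exists_of_sum_single_ne_zero hne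
      exact ⟨j, Fin.ext hj⟩
    choose f hf using hex
    obtain rfl : (fun v => i (f v)) = g := funext hf
    refine ⟨f, ?_, rfl⟩
    simp only [Finset.mem_filter, Finset.mem_univ, true_and]
    intro j
    rw [← hfib, hg, sum_single_apply hi']
  · intro f _
    -- Colours outside the range of i have empty fibres, which contribute z ∅ = 1.
    refine Fintype.prod_of_injective i hi _ _ ?_ ?_
    · intro j hj
      have : {v | i (f v) = j} = ∅ := Set.eq_empty_iff_forall_notMem.2 fun v hv => hj ⟨f v, hv⟩
      rw [this, hz]
    · intro j
      simp only [hi.eq_iff]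

end Counting

/-! ### Specialization of Ψ_ζ as a sum over colourings -/

section Evaluation

variable {R : Type v} [CommRing R]

theorem proj_basisElt (ζ : Alg.{u, v} R →ₗ[R] R) (n : ℕ) (Γ : Complex.{u}) :
    (ζ ∘ₗ proj R n) (basisElt R Γ) = if Nat.card Γ.V = n then ζ (basisElt R Γ) else 0 := by
  classical
  have h : proj R n (basisElt R Γ) = Finsupp.filter (fun c => c.order = n) (basisElt R Γ) := rfl
  rw [LinearMap.comp_apply, h, basisElt]
  split_ifs with hn
  · rw [Finsupp.filter_single_of_pos _ (by exact hn)]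
  · rw [Finsupp.filter_single_of_neg _ (by exact hn), map_zero]

theorem zetaComp_basisElt (ζ : Alg.{u, v} R →ₗ[R] R) {n : ℕ} (α : Composition n) (Γ : Complex.{u})
    [Fintype Γ.V] [DecidableEq Γ.V] :
    zetaComp ζ α (basisElt R Γ) = ∑ f : Γ.V → Fin α.length, ∏ j,
      if Nat.card {v | f v = j} = α.blocksFun j
        then ζ (basisElt R (Γ.induced {v | f v = j})) else 0 := by
  rw [zetaComp, LinearMap.comp_apply, lift_iterComul_basisElt]
  refine Finset.sum_congr rfl fun f _ => Finset.prod_congr rfl fun j _ => ?_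
  rw [proj_basisElt]
  rfl

/-- At most one composition of |V| has x^m among its monomials. If there is one, its ζ_α is the sum
over colourings with monomial x^m. If there is none, no colouring has this monomial, since every
colouring monomial has degree |V|. -/
theorem coeff_psi_basisElt (ζ : Alg.{u, v} R →ₗ[R] R) (Γ : Complex.{u})
    [Fintype Γ.V] [DecidableEq Γ.V] (hζ : ζ (basisElt R (Γ.induced ∅)) = 1) (t : ℕ) (m : ℕ →₀ ℕ)
    (hm : ∀ n ∈ m.support, n < t) :
    MvPowerSeries.coeff m (psi ζ (basisElt R Γ)).1 =
      ∑ g : Γ.V → Fin t with fiberCount (fun v => (g v : ℕ)) = m,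
        ∏ j, ζ (basisElt R (Γ.induced {v | g v = j})) := by
  classical
  have h : MvPowerSeries.coeff m (psi ζ (basisElt R Γ)).1 =
      ∑ α : Composition (Nat.card Γ.V), zetaComp ζ α (basisElt R Γ) *
        if ∃ i : Fin α.length → ℕ, StrictMono i ∧ m = ∑ j, Finsupp.single (i j) (α.blocksFun j)
          then 1 else 0 := by
    have h1 : psi ζ (basisElt R Γ) = ∑ α : Composition (Nat.card Γ.V),
        zetaComp ζ α (basisElt R Γ) • (⟨monomialQSym R α, monomialQSym_mem R α⟩ : QSym R) := by
      unfold psi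
      conv_lhs => unfold basisElt
      rw [Finsupp.linearCombination_single, one_smul]
      rfl
    rw [h1]
    simp only [AddSubmonoidClass.coe_finsetSum, map_sum, Submodule.coe_smul,
      MvPowerSeries.coeff_smul]
    rfl
  rw [h]
  by_cases hex : ∃ α : Composition (Nat.card Γ.V), ∃ i : Fin α.length → ℕ,
      StrictMono i ∧ m = ∑ j, Finsupp.single (i j) (α.blocksFun j)
  · obtain ⟨α, hα⟩ := hex
    rw [Finset.sum_eq_single α, if_pos hα, mul_one, zetaComp_basisElt]
    · obtain ⟨i, hi, hmi⟩ := hα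
      have hlt : ∀ j, i j < t := fun j => hm _ <| by
        rw [Finsupp.mem_support_iff, hmi, sum_single_apply hi.injective]
        exact Nat.one_le_iff_ne_zero.1 (α.one_le_blocksFun j)
      rw [sum_prod_fibers_eq (fun S => ζ (basisElt R (Γ.induced S))) hζ α.blocksFun
        (fun j => ⟨i j, hlt j⟩) (fun a b hab => hi.injective (Fin.mk.inj hab))]
      simp only [← hmi]
    · intro β _ hβ
      rw [if_neg fun hβ' => hβ (composition_unique hβ' hα), mul_zero]
    · simp
  · rw [Finset.sum_eq_zero fun α _ => by rw [if_neg fun hα => hex ⟨α, hα⟩, mul_zero],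
      Finset.filter_false_of_mem, Finset.sum_empty]
    intro g _ hg
    exact hex (exists_composition (hg ▸ fiberCount_degree fun v => (g v : ℕ)))

/-- The value of `Ψ_ζ(Γ)` at `t` ones is the `t`-fold convolution power of `ζ` at `Γ`. -/
theorem evalOnes_psi_basisElt (ζ : Alg.{u, v} R →ₗ[R] R) (Γ : Complex.{u})
    [Fintype Γ.V] [DecidableEq Γ.V] (hζ : ζ (basisElt R (Γ.induced ∅)) = 1) (t : ℕ) :
    evalOnes (psi ζ (basisElt R Γ)) t =
      ∑ g : Γ.V → Fin t, ∏ j, ζ (basisElt R (Γ.induced {v | g v = j})) := by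
  classical
  have key : ∀ m : ℕ →₀ ℕ, MvPowerSeries.coeff m (psi ζ (basisElt R Γ)).1 *
      (m.prod fun i e => (if i < t then (1 : R) else 0) ^ e) =
      ∑ g : Γ.V → Fin t with fiberCount (fun v => (g v : ℕ)) = m,
        ∏ j, ζ (basisElt R (Γ.induced {v | g v = j})) := by
    intro m
    by_cases hm : ∀ n ∈ m.support, n < t
    · rw [coeff_psi_basisElt ζ Γ hζ t m hm, Finsupp.prod, Finset.prod_eq_one, mul_one]
      intro n hn
      rw [if_pos (hm n hn), one_pow]
    -- A variable of index at least t is set to 0 and kills the left side; no colouring with t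
    -- colours uses it, so the right side is empty.
    · push Not at hm
      obtain ⟨n, hn, hnt⟩ := hm
      have hn0 := Finsupp.mem_support_iff.1 hn
      rw [Finsupp.prod, Finset.prod_eq_zero hn, mul_zero, Finset.filter_false_of_mem,
        Finset.sum_empty]
      · rintro g _ rfl
        rw [fiberCount_apply] at hn0
        have : IsEmpty {v | (g v : ℕ) = n} :=
          ⟨fun v => absurd (g v.1).2 (by rw [show (g v.1 : ℕ) = n from v.2]; exact hnt.not_gt)⟩
        exact hn0 Nat.card_of_isEmpty
      · rw [if_neg hnt.not_gt, zero_pow hn0]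
  unfold evalOnes
  simp only [key]
  rw [finsum_eq_sum_of_support_subset (s := Finset.univ.image
    fun g : Γ.V → Fin t => fiberCount (fun v => (g v : ℕ)))]
  · exact Finset.sum_fiberwise_of_maps_to (fun g _ => Finset.mem_image_of_mem _ (Finset.mem_univ g)) _
  · intro m hm
    obtain ⟨g, hg, _⟩ := Finset.exists_ne_zero_of_sum_ne_zero hm
    exact Finset.mem_coe.2 (Finset.mem_image.2 ⟨g, Finset.mem_univ _, (Finset.mem_filter.1 hg).2⟩)

end Evaluation


/-! ### Characters of forests and the Potts sum of a tree -/

section Graphs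

theorem graphRank_of_isAcyclic {V : Type u} [Finite V] {G : SimpleGraph V} (h : G.IsAcyclic) :
    graphRank G = G.edgeSet.ncard := by
  refine IsGreatest.csSup_eq ⟨⟨G, le_rfl, h, rfl⟩, ?_⟩
  rintro _ ⟨H, hH, _, rfl⟩
  exact Set.ncard_le_ncard (SimpleGraph.edgeSet_mono hH) (Set.toFinite _)

theorem mem_ofGraph_faces {V : Type u} [Finite V] [DecidableEq V] (G : SimpleGraph V)
    (X : Finset V) :
    X ∈ (ofGraph G).faces ↔ (∃ v, X = {v}) ∨ ∃ a b, G.Adj a b ∧ X = {a, b} := by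
  have h : X ∈ (ofGraph G).faces ↔ (∃ v, X = {v}) ∨ X ∈ Sym2.toFinset '' G.edgeSet := Iff.rfl
  rw [h]
  refine or_congr_right ⟨?_, ?_⟩
  · rintro ⟨e, he, rfl⟩
    induction e with
    | _ a b => exact ⟨a, b, he, by ext; simp⟩
  · rintro ⟨a, b, hab, rfl⟩
    exact ⟨s(a, b), hab, by ext; simp⟩

theorem skeletonOne_induced_ofGraph {V : Type u} [Finite V] [DecidableEq V] (G : SimpleGraph V)
    (S : Set V) : ((ofGraph G).induced S).skeletonOne = G.induce S := by
  have key : ∀ a b : S, (a ≠ b ∧ ∃ X : Finset S,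
      X.map (Function.Embedding.subtype (· ∈ S)) ∈ (ofGraph G).faces ∧
        ∀ x, x ∈ X ↔ x = a ∨ x = b) ↔ G.Adj a b := by
    intro a b
    constructor
    · rintro ⟨hab, X, hX, hx⟩
      obtain rfl : X = {a, b} := by ext; simp [hx]
      rw [mem_ofGraph_faces] at hX
      have hab' : (a : V) ≠ b := fun h => hab (Subtype.ext h)
      have hmap : ({a, b} : Finset S).map (Function.Embedding.subtype (· ∈ S)) =
          {(a : V), (b : V)} := by simp
      rw [hmap] at hX
      rcases hX with ⟨v, hv⟩ | ⟨c, d, hcd, h⟩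
      · have h1 : (a : V) ∈ ({v} : Finset V) := hv ▸ by simp
        have h2 : (b : V) ∈ ({v} : Finset V) := hv ▸ by simp
        rw [Finset.mem_singleton] at h1 h2
        exact absurd (h1.trans h2.symm) hab'
      · have h1 : (a : V) ∈ ({c, d} : Finset V) := h ▸ by simp
        have h2 : (b : V) ∈ ({c, d} : Finset V) := h ▸ by simp
        simp only [Finset.mem_insert, Finset.mem_singleton] at h1 h2
        rcases h1 with h1 | h1 <;> rcases h2 with h2 | h2
        · exact absurd (h1.trans h2.symm) hab'
        · rwa [h1, h2]
        · rw [h1, h2]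
          exact hcd.symm
        · exact absurd (h1.trans h2.symm) hab'
    · intro hab
      refine ⟨fun h => hab.ne (congrArg _ h), {a, b}, ?_, by simp⟩
      rw [mem_ofGraph_faces]
      exact Or.inr ⟨a, b, hab, by simp⟩
  ext a b
  exact key a b

theorem dim_induced_ofGraph_le {V : Type u} [Finite V] [DecidableEq V] (G : SimpleGraph V)
    (S : Set V) : ((ofGraph G).induced S).dim ≤ 1 := by
  have key : ∀ X : Finset S, X.map (Function.Embedding.subtype (· ∈ S)) ∈ (ofGraph G).faces →
      X.card - 1 ≤ 1 := by
    intro X hX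
    rw [mem_ofGraph_faces] at hX
    rw [← Finset.card_map (Function.Embedding.subtype (· ∈ S))]
    rcases hX with ⟨v, hv⟩ | ⟨a, b, _, h⟩
    · rw [hv]
      simp
    · rw [h]
      have := Finset.card_le_two (a := a) (b := b)
      omega
  unfold Complex.dim
  refine iSup₂_le fun X hX => ?_
  exact_mod_cast key X hX

variable {R : Type v} [CommRing R]

theorem zeta_basisElt (s : ℕ) (x : R) (Γ : Complex.{u}) :
    zeta s x (basisElt R Γ) = zetaComplex s x Γ := by
  unfold zeta basisElt
  rw [Finsupp.linearCombination_single, one_smul]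
  rfl

-- The dimension condition holds because s > 1, and an induced subgraph of a forest is a forest,
-- whose rank is its number of edges. Those edges are the edges of G with both ends in S.
open Classical in
theorem zeta_induced_ofGraph {V : Type u} [Fintype V] {G : SimpleGraph V}
    (hG : G.IsAcyclic) {s : ℕ} (hs : 1 < s) (x : R) (S : Set V) :
    zeta s x (basisElt R ((ofGraph G).induced S)) =
      ∏ e ∈ G.edgeFinset, if ∀ v ∈ e, v ∈ S then x else 1 := by
  have hd : ((ofGraph G).induced S).dim < (s : WithBot ℕ∞) :=
    (dim_induced_ofGraph_le G S).trans_lt (by exact_mod_cast hs)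
  have hr : graphRank ((ofGraph G).induced S).skeletonOne = (G.induce S).edgeSet.ncard := by
    rw [skeletonOne_induced_ofGraph]
    exact graphRank_of_isAcyclic (hG.induce S)
  rw [zeta_basisElt, zetaComplex, if_pos hd, mul_one, hr, Finset.prod_ite, Finset.prod_const_one,
    mul_one, Finset.prod_const]
  congr 1
  rw [← Set.ncard_coe_finset, ← Set.ncard_image_of_injective _ (Sym2.map.injective
    (Subtype.val_injective (p := (· ∈ S))))]
  congr 1
  ext e
  induction e with
  | _ a b =>
    simp only [Set.mem_image, Finset.coe_filter, SimpleGraph.mem_edgeFinset, Set.mem_ofPred_eq,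
      SimpleGraph.mem_edgeSet, Sym2.mem_iff, forall_eq_or_imp, forall_eq]
    constructor
    · rintro ⟨e, he, h⟩
      induction e with
      | _ c d =>
        rw [Sym2.map_mk, Sym2.eq_iff] at h
        rcases h with ⟨rfl, rfl⟩ | ⟨rfl, rfl⟩
        · exact ⟨he, c.2, d.2⟩
        · exact ⟨SimpleGraph.Adj.symm he, d.2, c.2⟩
    · rintro ⟨hab, ha, hb⟩
      exact ⟨s(⟨a, ha⟩, ⟨b, hb⟩), hab, rfl⟩

-- After exchanging the products, a monochromatic edge lies in exactly one colour class and any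
-- other edge in none.
open Classical in
theorem prod_zeta_fibers {V : Type u} [Fintype V] {G : SimpleGraph V}
    (hG : G.IsAcyclic) {s : ℕ} (hs : 1 < s) (x : R) {t : ℕ} (g : V → Fin t) :
    ∏ j, zeta s x (basisElt R ((ofGraph G).induced {v | g v = j})) =
      ∏ e ∈ G.edgeFinset, if (e.map g).IsDiag then x else 1 := by
  have h : ∀ j, zeta s x (basisElt R ((ofGraph G).induced {v | g v = j})) =
      ∏ e ∈ G.edgeFinset, if ∀ v ∈ e, g v = j then x else 1 :=
    fun j => (zeta_induced_ofGraph hG hs x {v | g v = j}).trans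
      (Finset.prod_congr rfl fun _ _ => by congr)
  rw [Finset.prod_congr rfl fun j _ => h j, Finset.prod_comm]
  refine Finset.prod_congr rfl fun e _ => ?_
  induction e with
  | _ a b =>
    simp only [Sym2.mem_iff, forall_eq_or_imp, forall_eq, Sym2.map_mk, Sym2.mk_isDiag_iff]
    by_cases h : g a = g b
    · simp [h]
    · rw [if_neg h]
      refine Finset.prod_eq_one fun j _ => if_neg ?_
      rintro ⟨rfl, h'⟩
      exact h h'.symm

-- The edge decomposition behind leaf removal: v is a leaf with neighbour u.
open Classical in
theorem edgeFinset_eq_of_degree_eq_one {V : Type u} [Fintype V] {G : SimpleGraph V} {u v : V}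
    (huv : G.Adj v u) (hu : ∀ w, G.Adj v w → w = u) :
    G.edgeFinset = insert s(v, u)
      ((G.induce {w | w ≠ v}).edgeFinset.image (Sym2.map Subtype.val)) := by
  ext e
  induction e with
  | _ a b =>
    simp only [SimpleGraph.mem_edgeFinset, SimpleGraph.mem_edgeSet, Finset.mem_insert,
      Finset.mem_image]
    constructor
    · intro hab
      by_cases ha : a = v
      · subst ha
        exact Or.inl (by rw [hu b hab])
      by_cases hb : b = v
      · subst hb
        exact Or.inl (by rw [hu a hab.symm, Sym2.eq_swap])
      exact Or.inr ⟨s(⟨a, ha⟩, ⟨b, hb⟩), hab, rfl⟩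
    · rintro (h | ⟨e, he, h⟩)
      · rw [← SimpleGraph.mem_edgeSet, h]
        exact huv
      · rw [← SimpleGraph.mem_edgeSet, ← h]
        induction e with
        | _ c d => exact he

open Classical in
/-- The Potts partition function of a tree. -/
theorem sum_prod_isDiag_of_isTree (x : R) (t n : ℕ) {V : Type u} [Fintype V] {G : SimpleGraph V}
    (hG : G.IsTree) (hn : Fintype.card V = n + 1) :
    (∑ g : V → Fin t, ∏ e ∈ G.edgeFinset, if (e.map g).IsDiag then x else 1) =
      (t : R) * (t - 1 + x) ^ n := by
  induction n generalizing V with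
  | zero =>
    have h := hG.card_edgeFinset
    have h0 : G.edgeFinset = ∅ := Finset.card_eq_zero.1 (by omega)
    simp [h0, hn]
  | succ n ih =>
    have : Nontrivial V := Fintype.one_lt_card_iff_nontrivial.1 (by omega)
    obtain ⟨v, hv⟩ := hG.exists_vert_degree_one_of_nontrivial
    have hconn := hG.connected.induce_compl_singleton_of_degree_eq_one hv
    obtain ⟨u, huv, hu⟩ := SimpleGraph.degree_eq_one_iff_existsUnique_adj.1 hv
    have hT : (G.induce {w | w ≠ v}).IsTree := ⟨hconn, hG.isAcyclic.induce _⟩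
    have hcard : Fintype.card {w // w ≠ v} = n + 1 := by
      rw [Fintype.card_subtype_compl, Fintype.card_subtype_eq]
      omega
    have hu' : u ≠ v := huv.ne'
    -- Split a colouring into the colour of the leaf v and a colouring of the remaining tree; the
    -- leaf edge is the only one that sees the colour of v.
    rw [edgeFinset_eq_of_degree_eq_one huv hu, ← (Equiv.funSplitAt v (Fin t)).symm.sum_comp,
      Fintype.sum_prod_type_right]
    have hterm : ∀ (a : Fin t) (g : {w // w ≠ v} → Fin t),
        (∏ e ∈ insert s(v, u)
            ((G.induce {w | w ≠ v}).edgeFinset.image (Sym2.map Subtype.val)),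
          if (e.map ((Equiv.funSplitAt v (Fin t)).symm (a, g))).IsDiag then x else 1) =
        (if a = g ⟨u, hu'⟩ then x else 1) *
          ∏ e ∈ (G.induce {w | w ≠ v}).edgeFinset, if (e.map g).IsDiag then x else 1 := by
      intro a g
      rw [Finset.prod_insert, Finset.prod_image (Sym2.map.injective Subtype.val_injective).injOn]
      · congr 1
        · simp [Equiv.funSplitAt, Equiv.piSplitAt, hu']
        · refine Finset.prod_congr rfl fun e _ => ?_
          rw [Sym2.map_map]
          have : ((Equiv.funSplitAt v (Fin t)).symm (a, g)) ∘ Subtype.val = g := by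
            funext w
            simp [Equiv.funSplitAt, Equiv.piSplitAt, w.2]
          exact congrArg (fun f : {w // w ≠ v} → Fin t =>
            if (Sym2.map f e).IsDiag then x else 1) this
      · intro h
        obtain ⟨e, _, he⟩ := Finset.mem_image.1 h
        have : v ∈ Sym2.map Subtype.val e := he ▸ Sym2.mem_mk_left v u
        obtain ⟨w, _, hw⟩ := Sym2.mem_map.1 this
        exact w.2 hw
    simp only [hterm, ← Finset.sum_mul]
    -- Whatever the colour b of the neighbour, one colour of the leaf gives x and the other t - 1
    -- give 1.
    have hone : ∀ b : Fin t, (∑ a : Fin t, if a = b then x else 1) = t - 1 + x := by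
      intro b
      have : ∀ a : Fin t, (if a = b then x else 1) = 1 + if a = b then x - 1 else 0 := by
        intro a
        split_ifs <;> ring
      simp only [this, Finset.sum_add_distrib, Finset.sum_ite_eq', Finset.mem_univ, if_true]
      simp
      ring
    simp only [hone, ← Finset.mul_sum]
    have h := ih hT hcard
    rw [pow_succ, ← mul_assoc, ← h, mul_comm]
    -- The two sums differ only in the presentation of their index types and instances.
    exact congrArg (· * _) (@Fintype.sum_equiv _ _ _ (_) (_) _ (Equiv.refl _) _ _ fun _ => rfl)

open Classical in
theorem evalOnes_psi_ofGraph_of_isTree {V : Type u} [Fintype V] {G : SimpleGraph V}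
    (hG : G.IsTree) {s : ℕ} (hs : 1 < s) (x : R) (t n : ℕ) (hn : Fintype.card V = n + 1) :
    evalOnes (psi (zeta s x) (basisElt R (ofGraph G))) t = (t : R) * (t - 1 + x) ^ n := by
  let _ : Fintype (ofGraph G).V := ‹Fintype V›
  have h0 : zeta s x (basisElt R ((ofGraph G).induced ∅)) = 1 := by
    refine (zeta_induced_ofGraph hG.isAcyclic hs x ∅).trans ?_
    refine Finset.prod_eq_one fun e _ => if_neg fun h => ?_
    induction e with
    | _ a b => exact h a (Sym2.mem_mk_left a b)
  rw [evalOnes_psi_basisElt _ _ h0, ← sum_prod_isDiag_of_isTree x t n hG hn]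
  exact Finset.sum_congr rfl fun g _ => prod_zeta_fibers hG.isAcyclic hs x g

end Graphs

/-! ### Expansion in binomial polynomials -/

section Binomial

variable {R : Type v} [CommRing R]

/-- The span of the binomial polynomials is stable under multiplication by t + y. No division
occurs, so the argument works in every characteristic. -/
theorem exists_binomial_combination (y : R) (n : ℕ) :
    ∃ c : ℕ →₀ R, ∀ t : ℤ, (t : R) * (t + y) ^ n =
      c.sum fun k a => a * (Ring.choose t k : ℤ) := by
  have hadd : ∀ (c d : ℕ →₀ R) (t : ℤ),
      ((c + d).sum fun k a => a * ((Ring.choose t k : ℤ) : R)) =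
      (c.sum fun k a => a * ((Ring.choose t k : ℤ) : R)) +
        d.sum fun k a => a * ((Ring.choose t k : ℤ) : R) := fun c d t =>
    Finsupp.sum_add_index' (by simp) (by intros; ring)
  have hmul : ∀ c : ℕ →₀ R, ∃ d : ℕ →₀ R, ∀ t : ℤ,
      ((t : R) + y) * (c.sum fun k a => a * ((Ring.choose t k : ℤ) : R)) =
        d.sum fun k a => a * ((Ring.choose t k : ℤ) : R) := by
    intro c
    induction c using Finsupp.induction_linear with
    | zero => exact ⟨0, by simp⟩
    | add c d hc hd =>
      obtain ⟨c', hc⟩ := hc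
      obtain ⟨d', hd⟩ := hd
      exact ⟨c' + d', fun t => by rw [hadd, hadd, mul_add, hc, hd]⟩
    | single k a =>
      -- The coefficients come from t · binom(t, k) = (k + 1) · binom(t, k + 1) + k · binom(t, k).
      refine ⟨Finsupp.single (k + 1) (a * (k + 1)) + Finsupp.single k (a * (k + y)), fun t => ?_⟩
      have h : ((k : ℤ) + 1) * Ring.choose t (k + 1) = Ring.choose t k * (t - k) := by
        have := Ring.choose_smul_choose t (Nat.le_succ k)
        rw [Nat.succ_eq_add_one, Nat.choose_succ_self_right, Nat.add_sub_cancel_left,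
          Ring.choose_one_right, nsmul_eq_mul] at this
        exact_mod_cast this
      have h' := congrArg (Int.cast (R := R)) h
      push_cast at h'
      rw [hadd, Finsupp.sum_single_index (by simp), Finsupp.sum_single_index (by simp),
        Finsupp.sum_single_index (by simp)]
      linear_combination (-a) * h'
  induction n with
  | zero =>
    refine ⟨Finsupp.single 1 1, fun t => ?_⟩
    rw [Finsupp.sum_single_index (by simp), Ring.choose_one_right]
    simp
  | succ n ih =>
    obtain ⟨c, hc⟩ := ih
    obtain ⟨d, hd⟩ := hmul c
    exact ⟨d, fun t => by rw [← hd, ← hc]; ring⟩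

end Binomial

end SimplicialHopf

/-! ### The value at t = -1 -/

theorem mainTheorem10 {K : Type*} [Field K] {V : Type*} [Finite V] [DecidableEq V]
    (T : SimpleGraph V) (hT : T.IsTree) (s : ℕ) (hs : 1 < s) :
    ∃ p : ℤ → RatFunc K,
      SimplicialHopf.IsPrincipalSpec
        (SimplicialHopf.psi (SimplicialHopf.zeta s (-RatFunc.X : RatFunc K))
          (SimplicialHopf.basisElt (RatFunc K) (SimplicialHopf.ofGraph T))) p ∧
      p (-1) = (-1) ^ Nat.card V * (RatFunc.X + 2) ^ (Nat.card V - 1) := by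
  have hV := Fintype.ofFinite V
  obtain ⟨v⟩ := hT.connected.nonempty
  -- A tree is nonempty, so the natural subtraction in the exponent |V| - 1 is not truncated.
  obtain ⟨n, hn⟩ : ∃ n, Fintype.card V = n + 1 :=
    ⟨_, (Nat.succ_pred_eq_of_pos (Fintype.card_pos_iff.2 ⟨v⟩)).symm⟩
  refine ⟨fun t => (t : RatFunc K) * ((t : RatFunc K) + (-1 - RatFunc.X)) ^ n, ⟨fun t => ?_,
    SimplicialHopf.exists_binomial_combination _ n⟩, ?_⟩
  · obtain rfl : ‹DecidableEq V› = Classical.decEq V := Subsingleton.elim _ _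
    rw [SimplicialHopf.evalOnes_psi_ofGraph_of_isTree hT hs _ t n hn]
    push_cast
    ring
  · beta_reduce
    rw [Nat.card_eq_fintype_card, hn, Nat.add_sub_cancel, pow_succ]
    -- The n factors contribute the sign (-1)^n; the leading factor t = -1 supplies the remaining
    -- one.
    have : (((-1 : ℤ) : RatFunc K) + (-1 - RatFunc.X)) = (-1) * (RatFunc.X + 2) := by
      push_cast
      ring
    rw [this, mul_pow]
    push_cast
    ring
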